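/- Let $X$ and $Y$ be (real or complex) Banach spaces over the same scalar field $\mathbb{K}$, let $S\colon X\to Y$ be a continuous linear operator, let $F\subset X$ be bounded and convex, and let $n\in\mathbb{N}_0$. A deterministic non-adaptive algorithm using $n$ measurements is a mapping $A\colon F\to Y$ of the form $A(f)=\phi(L_1(f),\dots,L_n(f))$ with continuous linear functionals $L_1,\dots,L_n\in X'$ and an arbitrary mapping $\phi\colon\mathbb{K}^n\to Y$. Let $\mathcal{A}_n^{\text{det-non}}$ be the class of all such algorithms, and let $\mathcal{A}_n^{\text{det-non-mb}}$ be the subclass of those $A$ that are $(\mathcal{B}_F,\mathcal{B}_Y)$-measurable, where $\mathcal{B}_Y$ is the Borel $\sigma$-algebra of $Y$ and $\mathcal{B}_F$ is the Borel $\sigma$-algebra on $F$ of the topology given by the distance $d(f,g)=\inf\{r>0 : f-g\in r(F-F)\}$, i.e., of the semi-norm whose unit ball is $F-F$. For $*\in\{\text{det-non},\text{det-non-mb}\}$ put \[ e_n^{*}(S,F) := \inf_{A\in\mathcal{A}_n^{*}}\ \sup_{f\in F}\ \|S(f)-A(f)\|_Y . \] Then \[ e_n^{\text{det-non-mb}}(S,F)\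 \le\ 8\, e_n^{\text{det-non}}(S,F). \] -/

import Mathlib

open scoped ENNReal Pointwise

noncomputable section

namespace LinearInformation

/-- The topology on `F` of the semi-norm whose unit ball is `F - F`: a subset `U` of `F` is open if
it contains, with each of its points `f`, all points of `F` in a ball around `f` for
the distance `gauge (F - F) (g - f)`. -/
def setTopology {X : Type*} [AddCommGroup X] [Module ℝ X] (F : Set X) : TopologicalSpace F where
  IsOpen U := ∀ f ∈ U, ∃ r : ℝ, 0 < r ∧
    ∀ g : F, gauge (F - F) ((g : X) - (f : X)) < r → g ∈ U
  isOpen_univ := fun _ _ => ⟨1, one_pos, fun _ _ => trivial⟩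
  isOpen_inter := by
    intro U V hU hV f hf
    obtain ⟨r, hr, h⟩ := hU f hf.1
    obtain ⟨s, hs, k⟩ := hV f hf.2
    exact ⟨min r s, lt_min hr hs, fun g hg =>
      ⟨h g (hg.trans_le (min_le_left _ _)), k g (hg.trans_le (min_le_right _ _))⟩⟩
  isOpen_sUnion := by
    intro 𝒰 h𝒰 f hf
    obtain ⟨U, hU, hfU⟩ := hf
    obtain ⟨r, hr, h⟩ := h𝒰 U hU f hfU
    exact ⟨r, hr, fun g hg => ⟨U, hU, h g hg⟩⟩

/-- The Borel `σ`-algebra on `F` of the topology `setTopology F`. -/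
def setBorel {X : Type*} [AddCommGroup X] [Module ℝ X] (F : Set X) : MeasurableSpace F :=
  @borel F (setTopology F)

/-- The deterministic non-adaptive algorithms `A = φ ∘ N : F → Y`, where the information mapping
`N = (L₁, …, Lₙ)` consists of `n` continuous linear functionals on `X` and the reconstruction
mapping `φ` is arbitrary. -/
def detNon (𝕜 : Type*) {X : Type*} [RCLike 𝕜] [NormedAddCommGroup X] [NormedSpace 𝕜 X]
    (n : ℕ) (F : Set X) (Y : Type*) : Set (F → Y) :=
  {A | ∃ (L : Fin n → StrongDual 𝕜 X) (φ : (Fin n → 𝕜) → Y),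
    ∀ f : F, A f = φ (fun k => L k (f : X))}

/-- The algorithms in `detNon` that are measurable as mappings from `F` to `Y`. -/
def detNonMb (𝕜 : Type*) {X : Type*} [RCLike 𝕜] [NormedAddCommGroup X] [NormedSpace 𝕜 X]
    [NormedSpace ℝ X] (n : ℕ) (F : Set X) (Y : Type*) [TopologicalSpace Y] : Set (F → Y) :=
  {A | A ∈ detNon 𝕜 n F Y ∧ @Measurable F Y (setBorel F) (borel Y) A}

/-- The worst-case error of `A` for approximating `S` over `F`. -/
def worstCaseError {X Y : Type*} [NormedAddCommGroup Y] (S : X → Y) (F : Set X) (A : F → Y) :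
    ℝ≥0∞ :=
  ⨆ f : F, ‖S (f : X) - A f‖ₑ

/-- The `n`-th minimal worst-case error of deterministic non-adaptive algorithms. -/
def errDetNon (𝕜 : Type*) {X Y : Type*} [RCLike 𝕜] [NormedAddCommGroup X] [NormedSpace 𝕜 X]
    [NormedAddCommGroup Y] (n : ℕ) (S : X → Y) (F : Set X) : ℝ≥0∞ :=
  ⨅ A ∈ detNon 𝕜 n F Y, worstCaseError S F A

/-- The `n`-th minimal worst-case error of measurable deterministic non-adaptive algorithms. -/
def errDetNonMb (𝕜 : Type*) {X Y : Type*} [RCLike 𝕜] [NormedAddCommGroup X] [NormedSpace 𝕜 X]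
    [NormedSpace ℝ X] [NormedAddCommGroup Y] (n : ℕ) (S : X → Y) (F : Set X) : ℝ≥0∞ :=
  ⨅ A ∈ detNonMb 𝕜 n F Y, worstCaseError S F A

end LinearInformation

end

namespace LinearInformation

open Set Metric

/-! If `A` has error `e`, points of `F` with equal information have `S`-values within `2e`. Since
the information is finite-dimensional and `F - F` is convex and symmetric, points with nearly equal
information have `S`-values within `2e + ε` (`exists_pos_forall_norm_le_add`). So rounding the
information to a countable dense subset of its range on `F` and returning `S` of a preimage in `F`
costs only `ε`. Rounding is Borel and the information is continuous on `F`, so the new algorithm is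
measurable. -/

/-- A convex symmetric set in a finite-dimensional space is a neighbourhood of zero in its span. -/
theorem exists_pos_forall_mem_smul {E : Type*} [NormedAddCommGroup E] [NormedSpace ℝ E]
    [FiniteDimensional ℝ E] {B : Set E} (hB : Convex ℝ B) (h0 : (0 : E) ∈ B)
    (hneg : ∀ x ∈ B, -x ∈ B) {δ : ℝ} (hδ : 0 < δ) :
    ∃ η : ℝ, 0 < η ∧ ∀ v ∈ B, ‖v‖ < η → ∃ w ∈ B, v = δ • w := by
  set V := Submodule.span ℝ B
  set B' : Set V := ((↑) : V → E) ⁻¹' B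
  have hB' : Convex ℝ B' := hB.linear_preimage V.subtype
  have hspan : Submodule.span ℝ B' = ⊤ := Submodule.span_span_coe_preimage
  have h0' : (0 : V) ∈ B' := h0
  have haff : affineSpan ℝ B' = ⊤ := by
    rw [AffineSubspace.affineSpan_eq_top_iff_vectorSpan_eq_top_of_nonempty ℝ V V ⟨0, h0'⟩,
      vectorSpan_eq_span_vsub_set_right ℝ h0']
    simpa using hspan
  obtain ⟨x, hx⟩ := hB'.interior_nonempty_iff_affineSpan_eq_top.2 haff
  have hx' : -x ∈ B' := hneg _ (interior_subset hx : x ∈ B')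
  -- By symmetry, zero is the midpoint of the interior point `x` and of `-x`.
  have hz : (0 : V) ∈ interior B' := by
    refine hB'.openSegment_interior_self_subset_interior hx hx' ?_
    exact ⟨1 / 2, 1 / 2, by norm_num, by norm_num, by norm_num, by simp⟩
  obtain ⟨ε, hε, hball⟩ := Metric.mem_nhds_iff.1 (mem_interior_iff_mem_nhds.1 hz)
  refine ⟨δ * ε, by positivity, fun v hv hvn => ⟨δ⁻¹ • v, ?_, ?_⟩⟩
  · have hm : (⟨δ⁻¹ • v, V.smul_mem _ (Submodule.subset_span hv)⟩ : V) ∈ B' := by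
      apply hball
      rw [mem_ball_zero_iff, Submodule.coe_norm, norm_smul, norm_inv, Real.norm_of_nonneg hδ.le,
        inv_mul_lt_iff₀ hδ]
      exact hvn
    exact hm
  · rw [smul_inv_smul₀ hδ.ne']

/-- A bounded real-linear map is continuous for the topology of the seminorm with unit ball
`F - F`, provided `F` is bounded. -/
theorem continuous_setTopology {X E : Type*} [NormedAddCommGroup X] [NormedSpace ℝ X]
    [NormedAddCommGroup E] [NormedSpace ℝ E] {F : Set X} (hF : Bornology.IsBounded F)
    (T : X →L[ℝ] E) : @Continuous F E (setTopology F) _ (fun f => T (f : X)) := by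
  let := setTopology F
  obtain ⟨C, hC, hCF⟩ := (hF.sub hF).exists_pos_norm_le
  refine ⟨fun U hU f hf => ?_⟩
  obtain ⟨ε, hε, hball⟩ := Metric.isOpen_iff.1 hU _ hf
  have hM : 0 < ‖T‖ + 1 := by positivity
  refine ⟨ε / ((‖T‖ + 1) * C), by positivity, fun g hg => hball ?_⟩
  obtain ⟨r, ⟨hr, hmem⟩, hlt⟩ := exists_lt_of_csInf_lt
    (⟨1, one_pos, by rw [one_smul]; exact sub_mem_sub g.2 f.2⟩ :
      {r : ℝ | 0 < r ∧ (g : X) - (f : X) ∈ r • (F - F)}.Nonempty) hg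
  obtain ⟨k, hk, hkeq⟩ := hmem
  have hnorm : ‖(g : X) - f‖ ≤ r * C := by
    rw [← hkeq]
    simp only [norm_smul, Real.norm_of_nonneg hr.le]
    exact mul_le_mul_of_nonneg_left (hCF k hk) hr.le
  rw [mem_ball, dist_eq_norm, ← map_sub]
  calc ‖T ((g : X) - f)‖ ≤ ‖T‖ * ‖(g : X) - f‖ := T.le_opNorm _
    _ ≤ (‖T‖ + 1) * (r * C) := by gcongr; linarith
    _ = r * ((‖T‖ + 1) * C) := by ring
    _ < ε := (lt_div_iff₀ (by positivity)).1 hlt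

/-- If `S` is small on the elements of `F - F` that the information mapping `T` does not see, then
it is nearly as small on those for which the information is small. -/
theorem exists_pos_forall_norm_le_add {X Y E : Type*} [NormedAddCommGroup X] [NormedSpace ℝ X]
    [NormedAddCommGroup Y] [NormedSpace ℝ Y] [NormedAddCommGroup E] [NormedSpace ℝ E]
    [FiniteDimensional ℝ E] {F : Set X} (hFb : Bornology.IsBounded F) (hFc : Convex ℝ F)
    (hne : F.Nonempty) (T : X →L[ℝ] E) (S : X →L[ℝ] Y) {a : ℝ} (ha : 0 ≤ a)
    (hS : ∀ f ∈ F, ∀ g ∈ F, T f = T g → ‖S f - S g‖ ≤ a) {ε : ℝ} (hε : 0 < ε) :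
    ∃ η : ℝ, 0 < η ∧ ∀ f ∈ F, ∀ g ∈ F, dist (T f) (T g) < η → ‖S f - S g‖ ≤ a + ε := by
  obtain ⟨C, hC, hCF⟩ := (hFb.sub hFb).exists_pos_norm_le
  have hconv : Convex ℝ (F - F) := hFc.sub hFc
  have hneg : ∀ x ∈ F - F, -x ∈ F - F := by
    rintro _ ⟨f, hf, g, hg, rfl⟩
    exact ⟨g, hg, f, hf, (neg_sub f g).symm⟩
  obtain ⟨x₀, hx₀⟩ := hne
  set D := a + ‖S‖ * C
  have hD : 0 ≤ D := by positivity
  -- The final estimate exceeds `a` by `δ * D`; the `+ 1` covers `D = 0`.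
  set δ := ε / (D + 1)
  have hδ : 0 < δ := by positivity
  have hδD : δ * D ≤ ε := by
    rw [div_mul_eq_mul_div, div_le_iff₀ (by positivity)]
    nlinarith
  obtain ⟨η, hη, hsmall⟩ := exists_pos_forall_mem_smul (B := T '' (F - F))
    (hconv.linear_image T.toLinearMap)
    ⟨0, ⟨x₀, hx₀, x₀, hx₀, sub_self _⟩, map_zero T⟩
    (by rintro _ ⟨x, hx, rfl⟩; exact ⟨-x, hneg x hx, map_neg T x⟩) hδ
  refine ⟨η, hη, fun f hf g hg hfg => ?_⟩
  have hh : f - g ∈ F - F := sub_mem_sub hf hg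
  obtain ⟨_, ⟨k, hk, rfl⟩, hTk⟩ := hsmall (T (f - g)) (mem_image_of_mem _ hh)
    (by rwa [map_sub, ← dist_eq_norm])
  have hpos : 0 < 1 + δ := by positivity
  -- Subtracting `δ • k` cancels the information of `f - g`; dividing by `1 + δ` makes the result a
  -- convex combination of `f - g` and `-k`, hence still in `F - F`.
  set m := (1 + δ)⁻¹ • (f - g) + (δ / (1 + δ)) • (-k)
  have hm : m ∈ F - F := hconv hh (hneg k hk) (by positivity) (by positivity) (by field_simp)
  have hdecomp : f - g = (1 + δ) • m + δ • k := by
    simp only [m, smul_add, smul_smul, mul_inv_cancel₀ hpos.ne', mul_div_cancel₀ δ hpos.ne',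
      one_smul, smul_neg, neg_add_cancel_right]
  have hTm : T m = 0 := by
    have h := congrArg T hdecomp
    rw [map_add, map_smul, map_smul, hTk, right_eq_add] at h
    exact (smul_eq_zero.1 h).resolve_left hpos.ne'
  have hSm : ‖S m‖ ≤ a := by
    obtain ⟨f', hf', g', hg', hm'⟩ := hm
    rw [← hm', map_sub] at hTm ⊢
    exact hS f' hf' g' hg' (sub_eq_zero.1 hTm)
  have hSk : ‖S k‖ ≤ ‖S‖ * C :=
    (S.le_opNorm k).trans (mul_le_mul_of_nonneg_left (hCF k hk) (norm_nonneg S))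
  calc ‖S f - S g‖ = ‖(1 + δ) • S m + δ • S k‖ := by
        rw [← map_sub, hdecomp, map_add, map_smul, map_smul]
    _ ≤ (1 + δ) * ‖S m‖ + δ * ‖S k‖ := by
        refine (norm_add_le _ _).trans_eq ?_
        rw [norm_smul, norm_smul, Real.norm_of_nonneg hpos.le, Real.norm_of_nonneg hδ.le]
    _ ≤ (1 + δ) * a + δ * (‖S‖ * C) := by gcongr
    _ = a + δ * D := by ring
    _ ≤ a + ε := by gcongr

open Classical in
/-- Every nonempty subset of a separable metric space admits a countably valued Borel map of the
whole space into it that moves the points of the set by less than `η`. -/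
theorem exists_measurable_index {E : Type*} [MetricSpace E] [SecondCountableTopology E]
    {s : Set E} (hs : s.Nonempty) {η : ℝ} (hη : 0 < η) :
    ∃ (q : ℕ → E) (i : E → ℕ), (∀ k, q k ∈ s) ∧ @Measurable E ℕ (borel E) ⊤ i ∧
      ∀ y ∈ s, dist y (q (i y)) < η := by
  let : MeasurableSpace E := borel E
  have : BorelSpace E := ⟨rfl⟩
  have : Nonempty s := hs.to_subtype
  set q : ℕ → E := fun k => (TopologicalSpace.denseSeq s k : E)
  -- The second alternative makes the search for the first index succeed at every `y`; density rules
  -- it out on `s`.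
  have hp : ∀ y, ∃ k, dist y (q k) < η ∨ ∀ j, ¬ dist y (q j) < η := by
    intro y
    by_cases h : ∃ k, dist y (q k) < η
    · exact h.imp fun _ hk => Or.inl hk
    · exact ⟨0, Or.inr (not_exists.1 h)⟩
  have hmeas : ∀ k, MeasurableSet {y | dist y (q k) < η} := fun k => measurableSet_ball
  refine ⟨q, fun y => Nat.find (hp y), fun k => (TopologicalSpace.denseSeq s k).2,
    measurable_find hp fun k => ?_, fun y hy => ?_⟩
  · rw [ofPred_or, ofPred_forall]
    exact (hmeas k).union (MeasurableSet.iInter fun j => (hmeas j).compl)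
  · refine (Nat.find_spec (hp y)).resolve_right fun h => ?_
    obtain ⟨k, hk⟩ := (TopologicalSpace.denseRange_denseSeq s).exists_dist_lt ⟨y, hy⟩ hη
    exact h _ hk

end LinearInformation

open LinearInformation Set in
theorem mainTheorem11 {𝕜 X Y : Type*} [RCLike 𝕜]
    [NormedAddCommGroup X] [NormedSpace 𝕜 X] [NormedSpace ℝ X] [IsScalarTower ℝ 𝕜 X]
    [CompleteSpace X]
    [NormedAddCommGroup Y] [NormedSpace 𝕜 Y] [CompleteSpace Y]
    (S : X →L[𝕜] Y) (F : Set X) (hFb : Bornology.IsBounded F) (hFc : Convex ℝ F) (n : ℕ) :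
    LinearInformation.errDetNonMb 𝕜 n (fun x => S x) F ≤
      8 * LinearInformation.errDetNon 𝕜 n (fun x => S x) F := by
  let : NormedSpace ℝ Y := NormedSpace.restrictScalars ℝ 𝕜 Y
  have : IsScalarTower ℝ 𝕜 Y := RestrictScalars.isScalarTower ℝ 𝕜 Y
  have hreduce : ∀ A ∈ detNon 𝕜 n F Y, errDetNonMb 𝕜 n (fun x => S x) F ≤
      8 * worstCaseError (fun x => S x) F A := by
    rintro A ⟨L, φ, hA⟩
    set e := worstCaseError (fun x => S x) F A
    rcases F.eq_empty_or_nonempty with rfl | hne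
    · have hmeas : @Measurable _ Y (setBorel ∅) (borel Y) A :=
        @measurable_of_empty _ _ (setBorel ∅) (borel Y) _ A
      exact (iInf₂_le A ⟨⟨L, φ, hA⟩, hmeas⟩).trans (by simp [worstCaseError])
    by_cases htop : e = ⊤
    · simp [htop]
    have hbound : ∀ f (hf : f ∈ F), ‖S f - A ⟨f, hf⟩‖ ≤ e.toReal := by
      intro f hf
      rw [← toReal_enorm]
      exact ENNReal.toReal_mono htop (le_iSup (fun f : F => ‖S (f : X) - A f‖ₑ) ⟨f, hf⟩)
    set T : X →L[ℝ] (Fin n → 𝕜) := (ContinuousLinearMap.pi L).restrictScalars ℝ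
    have hS : ∀ f ∈ F, ∀ g ∈ F, T f = T g → ‖S.restrictScalars ℝ f - S.restrictScalars ℝ g‖ ≤
        2 * e.toReal := by
      intro f hf g hg hfg
      have hAfg : A ⟨f, hf⟩ = A ⟨g, hg⟩ := by
        rw [hA, hA]
        exact congrArg φ hfg
      calc ‖S f - S g‖ = ‖(S f - A ⟨f, hf⟩) - (S g - A ⟨g, hg⟩)‖ := by rw [hAfg]; congr 1; abel
        _ ≤ ‖S f - A ⟨f, hf⟩‖ + ‖S g - A ⟨g, hg⟩‖ := norm_sub_le _ _
        _ ≤ 2 * e.toReal := by linarith [hbound f hf, hbound g hg]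
    refine ENNReal.le_of_forall_pos_le_add fun ε hε _ => ?_
    obtain ⟨η, hη, hηS⟩ := exists_pos_forall_norm_le_add hFb hFc hne T (S.restrictScalars ℝ)
      (by positivity) hS (NNReal.coe_pos.2 hε)
    obtain ⟨q, i, hq, hi, hqi⟩ := exists_measurable_index (hne.image T) hη
    choose g hgF hgq using hq
    have hmeas : @Measurable F Y (setBorel F) (borel Y) fun f => S (g (i (T f))) := by
      let : TopologicalSpace F := setTopology F
      let : MeasurableSpace F := setBorel F
      have : BorelSpace F := ⟨rfl⟩
      let : MeasurableSpace (Fin n → 𝕜) := borel _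
      have : BorelSpace (Fin n → 𝕜) := ⟨rfl⟩
      let : MeasurableSpace Y := borel Y
      have hcont : Continuous fun f : F => T f := continuous_setTopology hFb T
      -- Factoring through discrete `ℕ` avoids any separability of `Y`.
      exact (measurable_from_top (f := fun k : ℕ => S (g k))).comp (hi.comp hcont.measurable)
    refine (iInf₂_le (fun f : F => S (g (i (T f))))
      ⟨⟨L, fun y => S (g (i y)), fun f => rfl⟩, hmeas⟩).trans (iSup_le fun f => ?_)
    have h := hηS f f.2 (g (i (T f))) (hgF _) (by
      rw [hgq]
      exact hqi _ (mem_image_of_mem _ f.2))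
    calc ‖S f - S (g (i (T f)))‖ₑ = ENNReal.ofReal ‖S f - S (g (i (T f)))‖ :=
          (ofReal_norm _).symm
      _ ≤ ENNReal.ofReal (2 * e.toReal + ε) := ENNReal.ofReal_le_ofReal h
      _ = 2 * e + ε := by
          rw [ENNReal.ofReal_add (by positivity) ε.coe_nonneg, ENNReal.ofReal_mul zero_le_two,
            ENNReal.ofReal_toReal htop, ENNReal.ofReal_coe_nnreal, ENNReal.ofReal_ofNat]
      -- The construction already gives the factor 2.
      _ ≤ 8 * e + ε := by
          gcongr
          norm_num
  rw [errDetNon, ENNReal.mul_iInf_of_ne (by norm_num) (by norm_num)]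
  refine le_iInf fun A => ?_
  rw [ENNReal.mul_iInf_of_ne (by norm_num) (by norm_num)]
  exact le_iInf (hreduce A)
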